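/- Let $n\ge 1$, $1\le r\le\infty$, and let $\mathbb{D}^n\subset\mathbb{C}^n$ be the open unit polydisc. Let $f$ be a holomorphic function in a neighbourhood of $\overline{\mathbb{D}^n}$ and let $Z=f^{-1}(0)$. For an open set $\Omega\subseteq\mathbb{C}^n$, $L^r_c(\Omega)$ denotes the space of functions in $L^r$ that vanish almost everywhere outside some compact subset of $\Omega$, regarded as functions on $\mathbb{C}^n$ by extension by zero; a form belongs to $L^r(\Omega)$ or $L^r_c(\Omega)$ if all its coefficients do, where the coefficients of a $(0,q)$-form $\sum_{|J|=q}\omega_J\,d\bar z_J$ are the functions $\omega_J$, $J=\{j_1<\dots<j_q\}\subseteq\{1,\dots,n\}$. Let $\omega$ be a $(0,n)$-form in $L^r_c(\mathbb{D}^n\setminus Z)$. Then for every $k\in\mathbb{N}=\{0,1,2,\dots\}$ there is a $(0,n-1)$-form $\eta\in L^r(\mathbb{D}^n)$ such that 1. $\bar\partial\eta=\omega$ on $\mathbb{D}^n$ in the sense of distributions; 2. $f^{-k}\eta\in L^r(\mathbb{D}^n)$ (where, for $k\ge1$, $f^{-k}\eta$ is given the value $0$ at the points of $Z$); 3. all the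 coefficients of $\eta$, except at most one, belong to $L^r_c(\mathbb{D}^n\setminus Z)$. -/

import Mathlib

open MeasureTheory
open scoped ENNReal

/-- The open unit polydisc in `ℂⁿ`. -/
def unitPolydisc (n : ℕ) : Set (Fin n → ℂ) := {z | ∀ i, ‖z i‖ < 1}

/-- The closed unit polydisc in `ℂⁿ`. -/
def closedUnitPolydisc (n : ℕ) : Set (Fin n → ℂ) := {z | ∀ i, ‖z i‖ ≤ 1}

/-- The Wirtinger derivative `∂φ/∂z̄_j = (∂φ/∂x_j + i ∂φ/∂y_j) / 2`, where `z_j = x_j + i y_j`. -/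
noncomputable def wirtingerBar {n : ℕ} (j : Fin n) (φ : (Fin n → ℂ) → ℂ) (z : Fin n → ℂ) : ℂ :=
  (1 / 2 : ℂ) * (fderiv ℝ φ z (Pi.single j 1) + Complex.I * fderiv ℝ φ z (Pi.single j Complex.I))

/-- A `(0,q)`-form on `ℂⁿ`, given by its coefficients: `ω` stands for `∑_{|J| = q} ω_J dz̄_J`,
where `dz̄_J = dz̄_{j₁} ∧ ⋯ ∧ dz̄_{j_q}` if the elements of `J` are `j₁ < ⋯ < j_q`. -/
abbrev ZeroForm (n q : ℕ) : Type := {J : Finset (Fin n) // J.card = q} → (Fin n → ℂ) → ℂ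

/-- The multi-index `I ∖ {j}` for `j ∈ I`. -/
def eraseIndex {n q p : ℕ} (h : q + 1 = p) (I : {J : Finset (Fin n) // J.card = p})
    (j : {j : Fin n // j ∈ I.1}) : {J : Finset (Fin n) // J.card = q} :=
  ⟨I.1.erase j.1, by
    have h1 := Finset.card_erase_of_mem j.2
    have h2 := I.2
    omega⟩

/-- The sign `(-1) ^ #{i ∈ I : i < j}` for which `dz̄_j ∧ dz̄_{I ∖ {j}} = sign • dz̄_I`. -/
def indexSign {n : ℕ} (I : Finset (Fin n)) (j : Fin n) : ℂ :=
  (-1) ^ (I.filter (fun i => i < j)).card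

/-- `∂̄η = ω` on the open set `Ω` in the sense of distributions, for a `(0,q)`-form `η` and a
`(0,q+1)`-form `ω`, both with coefficients locally integrable on `Ω`: for every multi-index `I` of
length `q+1`, `∑_{j ∈ I} sign(j, I) ∂η_{I ∖ {j}}/∂z̄_j = ω_I` as distributions on `Ω`. -/
def WeakDbarEq {n q p : ℕ} (h : q + 1 = p) (Ω : Set (Fin n → ℂ))
    (η : ZeroForm n q) (ω : ZeroForm n p) : Prop :=
  (∀ J, LocallyIntegrableOn (η J) Ω) ∧ (∀ I, LocallyIntegrableOn (ω I) Ω) ∧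
  ∀ (I : {J : Finset (Fin n) // J.card = p}) (φ : (Fin n → ℂ) → ℂ),
    ContDiff ℝ (⊤ : ℕ∞) φ → HasCompactSupport φ → tsupport φ ⊆ Ω →
    ∑ j : {j : Fin n // j ∈ I.1},
        indexSign I.1 j.1 * ∫ z in Ω, η (eraseIndex h I j) z * wirtingerBar j.1 φ z
      = - ∫ z in Ω, ω I z * φ z

/-- The space `L^r(Ω)`, for functions. -/
def InLr {n : ℕ} (r : ℝ≥0∞) (Ω : Set (Fin n → ℂ)) (g : (Fin n → ℂ) → ℂ) : Prop :=
  MemLp g r (volume.restrict Ω)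

/-- The space `L^r_c(Ω)`: functions in `L^r` whose (essential) support is a compact subset of `Ω`.
As usual they are regarded as functions on the whole of `ℂⁿ`, vanishing outside `Ω`. -/
def InLrc {n : ℕ} (r : ℝ≥0∞) (Ω : Set (Fin n → ℂ)) (g : (Fin n → ℂ) → ℂ) : Prop :=
  MemLp g r volume ∧ ∃ K : Set (Fin n → ℂ), IsCompact K ∧ K ⊆ Ω ∧ ∀ᵐ z ∂volume, z ∉ K → g z = 0

/-! A form of top degree has one coefficient `g`, so it suffices to solve a single equation in the
first variable and let all other coefficients of `η` vanish. The support of `g` is a compact set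
avoiding `Z`, so `h = g / f ^ k` is still in `L^r`. Let `T` be its Cauchy transform in that
variable. Multiplication by the holomorphic `f ^ k` commutes with `∂̄`, hence `f ^ k * T` solves the
equation for `f ^ k * h = g` and is visibly divisible by `f ^ k`.

Two facts carry this. The kernel `1 / (π w)`, cut off at radius 2, is integrable, so `T` preserves
`L^r` (`MemLp.integral_kernel_mul_comp_sub`). Fubini moves `T` onto the test function
(`integral_kernel_mul_comp_sub_mul`), where Cauchy–Pompeiu inverts `∂̄` on each slice
(`integral_inv_mul_mul_wirtingerBar`). -/

/-! ### The Cauchy–Pompeiu formula in the plane -/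

theorem integrableOn_polar_target_of_continuous {A : ℝ × ℝ → ℂ} (hA : Continuous A) {R : ℝ}
    (hR : ∀ p : ℝ × ℝ, R < p.1 → A p = 0) :
    IntegrableOn A (Set.Ioi 0 ×ˢ Set.Ioo (-Real.pi) Real.pi) := by
  have h1 : IntegrableOn A (Set.Icc 0 R ×ˢ Set.Icc (-Real.pi) Real.pi) :=
    hA.continuousOn.integrableOn_compact (isCompact_Icc.prod isCompact_Icc)
  refine h1.of_forall_sdiff_eq_zero (measurableSet_Ioi.prod measurableSet_Ioo) ?_
  rintro ⟨a, b⟩ ⟨⟨ha, hb⟩, hn⟩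
  refine hR _ ?_
  by_contra hlt
  exact hn ⟨⟨le_of_lt ha, not_lt.1 hlt⟩, Set.Ioo_subset_Icc_self hb⟩

/-- The Cauchy–Pompeiu formula for compactly supported `C¹` functions. -/
theorem integral_inv_mul_dbar_eq {u : ℂ → ℂ} (hu : ContDiff ℝ 1 u) (hc : HasCompactSupport u) :
    ∫ w : ℂ, w⁻¹ * ((1 / 2 : ℂ) * (fderiv ℝ u w 1 + Complex.I * fderiv ℝ u w Complex.I))
      = -(Real.pi : ℂ) * u 0 := by
  set e : ℝ → ℂ := fun t => Complex.exp (t * Complex.I) with he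
  have hec : Continuous e := by fun_prop
  have hed : ∀ t, HasDerivAt e (Complex.I * e t) t := fun t => by
    have := ((Complex.ofRealCLM.hasDerivAt (x := t)).mul_const Complex.I).cexp
    simpa [he, mul_comm] using this
  have hdu : Continuous (fderiv ℝ u) := hu.continuous_fderiv one_ne_zero
  have hud : ∀ w, HasFDerivAt u (fderiv ℝ u w) w := fun w =>
    (hu.differentiable one_ne_zero w).hasFDerivAt
  obtain ⟨R, hRpos, hR⟩ : ∃ R : ℝ, 0 < R ∧ ∀ w, R < ‖w‖ → fderiv ℝ u w = 0 := by
    obtain ⟨R, hRpos, hR⟩ := (hc.fderiv ℝ).isBounded.exists_pos_norm_le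
    refine ⟨R, hRpos, fun w hw => ?_⟩
    by_contra h
    exact absurd (hR w (subset_tsupport _ h)) (not_le.2 hw)
  have henorm : ∀ t, ‖e t‖ = 1 := fun t => Complex.norm_exp_ofReal_mul_I t
  -- In polar coordinates `A = ∂u/∂s` and `s * B = ∂u/∂t`; the Jacobian `s` cancels the singularity
  -- of `w⁻¹`, leaving the integrand `(A + i B) / 2`.
  set A : ℝ × ℝ → ℂ := fun p => fderiv ℝ u (p.1 * e p.2) (e p.2) with hA
  set B : ℝ × ℝ → ℂ := fun p => fderiv ℝ u (p.1 * e p.2) (Complex.I * e p.2) with hB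
  have hAc : Continuous A := by
    refine (hdu.comp ?_).clm_apply ?_ <;> fun_prop
  have hBc : Continuous B := by
    refine (hdu.comp ?_).clm_apply ?_ <;> fun_prop
  have hzero : ∀ p : ℝ × ℝ, R < p.1 → fderiv ℝ u (p.1 * e p.2) = 0 := fun p hp => by
    refine hR _ ?_
    rw [norm_mul, henorm, mul_one, Complex.norm_real]
    exact hp.trans_le (le_abs_self _)
  have hAi := integrableOn_polar_target_of_continuous hAc (R := R) fun p hp => by
    simp [hA, hzero p hp]
  have hBi := integrableOn_polar_target_of_continuous hBc (R := R) fun p hp => by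
    simp [hB, hzero p hp]
  have hAint : ∫ p in Set.Ioi (0:ℝ) ×ˢ Set.Ioo (-Real.pi) Real.pi, A p
      = -(2 * Real.pi : ℂ) * u 0 := by
    rw [Measure.volume_eq_prod, ← setIntegral_prod_swap, setIntegral_prod]
    · have : ∀ t : ℝ, ∫ s in Set.Ioi (0:ℝ), A (s, t) = - u 0 := fun t => by
        have hder : ∀ s : ℝ, HasDerivAt (fun s : ℝ => u (s * e t)) (A (s, t)) s := fun s => by
          have h1 : HasDerivAt (fun s : ℝ => (s : ℂ) * e t) (e t) s := by
            simpa using (Complex.ofRealCLM.hasDerivAt (x := s)).mul_const (e t)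
          exact (hud _).comp_hasDerivAt s h1
        have hs : HasCompactSupport (fun s : ℝ => u (s * e t)) := by
          refine hc.comp_isClosedEmbedding (g := fun s : ℝ => (s : ℂ) * e t) ?_
          refine Isometry.isClosedEmbedding (Isometry.of_dist_eq fun x y => ?_)
          rw [dist_eq_norm, ← sub_mul, norm_mul, henorm, mul_one, ← Complex.ofReal_sub,
            Complex.norm_real, dist_eq_norm]
        have hcd : ContDiff ℝ 1 (fun s : ℝ => u (s * e t)) := by
          refine hu.comp ?_
          exact (Complex.ofRealCLM.contDiff).mul contDiff_const
        have := hs.integral_Ioi_deriv_eq hcd 0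
        rw [show deriv (fun s : ℝ => u (s * e t)) = fun s => A (s, t) from
          funext fun s => (hder s).deriv] at this
        simpa using this
      simp only [Prod.swap_prod_mk, this]
      simp [Measure.real, Real.pi_pos.le, ← two_mul]
    · exact hAi.swap
  -- On each circle `B` is the derivative of a periodic function of the angle.
  have hBint : ∫ p in Set.Ioi (0:ℝ) ×ˢ Set.Ioo (-Real.pi) Real.pi, B p = 0 := by
    rw [Measure.volume_eq_prod, setIntegral_prod _ hBi]
    refine setIntegral_eq_zero_of_forall_eq_zero fun s hs => ?_
    have hs0 : (s : ℂ) ≠ 0 := by exact_mod_cast (ne_of_gt hs : s ≠ 0)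
    have hder : ∀ t : ℝ, HasDerivAt (fun t : ℝ => (s : ℂ)⁻¹ * u (s * e t)) (B (s, t)) t := by
      intro t
      have h1 : HasDerivAt (fun t : ℝ => (s : ℂ) * e t) (s * (Complex.I * e t)) t :=
        (hed t).const_mul _
      have h2 := ((hud _).comp_hasDerivAt t h1).const_mul (s : ℂ)⁻¹
      refine h2.congr_deriv ?_
      rw [← Complex.real_smul (x := s) (z := Complex.I * e t), map_smul, Complex.real_smul,
        inv_mul_cancel_left₀ hs0]
    rw [← integral_Ioc_eq_integral_Ioo, ← intervalIntegral.integral_of_le (by linarith [Real.pi_pos]),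
      intervalIntegral.integral_eq_sub_of_hasDerivAt (fun t _ => hder t)
        ((hBc.comp (Continuous.prodMk_right s)).intervalIntegrable _ _)]
    have : e (-Real.pi) = e Real.pi := by
      simp [he, Complex.exp_neg, Complex.exp_pi_mul_I]
    rw [this, sub_self]
  rw [← Complex.integral_comp_polarCoord_symm, polarCoord_target]
  have hcongr : ∀ p ∈ Set.Ioi (0:ℝ) ×ˢ Set.Ioo (-Real.pi) Real.pi,
      p.1 • ((Complex.polarCoord.symm p)⁻¹ * ((1 / 2 : ℂ) *
        (fderiv ℝ u (Complex.polarCoord.symm p) 1 +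
          Complex.I * fderiv ℝ u (Complex.polarCoord.symm p) Complex.I)))
      = (1 / 2 : ℂ) * (A p + Complex.I * B p) := by
    rintro ⟨s, t⟩ ⟨hs, -⟩
    have hs0 : (s : ℂ) ≠ 0 := by exact_mod_cast (ne_of_gt hs : s ≠ 0)
    have het : e t = Real.cos t + Real.sin t * Complex.I := by
      simp [he, Complex.exp_mul_I]
    have heinv : (e t)⁻¹ = Real.cos t - Real.sin t * Complex.I := by
      rw [he, ← Complex.exp_neg, ← neg_mul, Complex.exp_mul_I]
      simp [sub_eq_add_neg]
    rw [Complex.polarCoord_symm_apply]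
    simp only [hA, hB, ← het]
    set D := fderiv ℝ u (s * e t)
    have h1 : D (e t) = Real.cos t * D 1 + Real.sin t * D Complex.I := by
      conv_lhs => rw [het, show (Real.cos t : ℂ) + Real.sin t * Complex.I
        = Real.cos t • (1:ℂ) + Real.sin t • Complex.I by simp]
      rw [map_add, map_smul, map_smul]; simp
    have h2 : D (Complex.I * e t) = -(Real.sin t * D 1) + Real.cos t * D Complex.I := by
      conv_lhs => rw [het, show Complex.I * ((Real.cos t : ℂ) + Real.sin t * Complex.I)
        = (-Real.sin t) • (1:ℂ) + Real.cos t • Complex.I by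
          simp only [Complex.real_smul]; push_cast
          linear_combination Complex.sin t * Complex.I_sq]
      rw [map_add, map_smul, map_smul]; simp
    rw [h1, h2, mul_inv, heinv, Complex.real_smul]
    field_simp
    linear_combination (-(Real.sin t : ℂ) * D Complex.I) * Complex.I_sq
  rw [setIntegral_congr_fun (measurableSet_Ioi.prod measurableSet_Ioo) hcongr,
    integral_const_mul, integral_add hAi (hBi.const_mul _), integral_const_mul, hAint, hBint]
  ring

/-! ### Convolution with a kernel living on a smaller space -/

section PartialConvolution

variable {X G : Type*} [MeasurableSpace X] [AddCommGroup G] [MeasurableSpace G]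
  [MeasurableAdd₂ G] {μ : Measure X} [SFinite μ] {ν : Measure G} [SFinite ν]
  [ν.IsAddRightInvariant]

theorem measurePreserving_add_shear {c : X → G} (hc : Measurable c) :
    MeasurePreserving (fun p : X × G => (p.1, p.2 + c p.1)) (μ.prod ν) (μ.prod ν) :=
  (MeasurePreserving.id μ).skew_product (g := fun x y => y + c x)
    (measurable_snd.add (hc.comp measurable_fst)) (Filter.Eventually.of_forall fun x =>
      map_add_right_eq_self ν (c x))

variable [MeasurableNeg G]

theorem measurePreserving_sub_shear {c : X → G} (hc : Measurable c) :
    MeasurePreserving (fun p : X × G => (p.1, p.2 - c p.1)) (μ.prod ν) (μ.prod ν) := by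
  simpa only [sub_eq_add_neg] using measurePreserving_add_shear (μ := μ) (ν := ν)
    (c := fun x => -c x) hc.neg

/-- By Tonelli and invariance under the shear, the integral equals `μ(X)` times the `r`-th power of
the norm of `h`. -/
theorem lintegral_eLpNorm_comp_sub_rpow_lt_top [IsFiniteMeasure μ] {c : X → G} (hc : Measurable c)
    {h : G → ℂ} (hm : StronglyMeasurable h) {r : ℝ≥0∞} (hr0 : r ≠ 0) (hr : r ≠ ∞)
    (hh : MemLp h r ν) :
    ∫⁻ z, eLpNorm (fun w => h (z - c w)) r μ ^ r.toReal ∂ν < ∞ := by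
  have hpos : 0 < r.toReal := ENNReal.toReal_pos hr0 hr
  have hF : Measurable fun p : X × G => ‖h p.2‖ₑ ^ r.toReal :=
    (hm.measurable.comp measurable_snd).enorm.pow_const _
  have hmp := measurePreserving_sub_shear (μ := μ) (ν := ν) hc
  have e1 : ∀ z, eLpNorm (fun w => h (z - c w)) r μ ^ r.toReal
      = ∫⁻ w, ‖h (z - c w)‖ₑ ^ r.toReal ∂μ := fun z => by
    rw [eLpNorm_eq_lintegral_rpow_enorm_toReal hr0 hr, ← ENNReal.rpow_mul,
      one_div_mul_cancel hpos.ne', ENNReal.rpow_one]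
  calc ∫⁻ z, eLpNorm (fun w => h (z - c w)) r μ ^ r.toReal ∂ν
      = ∫⁻ z, ∫⁻ w, ‖h (z - c w)‖ₑ ^ r.toReal ∂μ ∂ν := lintegral_congr e1
    _ = ∫⁻ p : X × G, ‖h (p.2 - c p.1)‖ₑ ^ r.toReal ∂μ.prod ν :=
        (lintegral_prod_symm' _ (hF.comp hmp.measurable)).symm
    _ = ∫⁻ p : X × G, ‖h p.2‖ₑ ^ r.toReal ∂μ.prod ν := hmp.lintegral_comp hF
    _ = (∫⁻ z, ‖h z‖ₑ ^ r.toReal ∂ν) * μ Set.univ := by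
        rw [lintegral_prod_symm' _ hF]
        simp only [lintegral_const]
        rw [lintegral_mul_const' _ _ (measure_ne_top μ _)]
    _ < ∞ := ENNReal.mul_lt_top
        (lintegral_rpow_enorm_lt_top_of_eLpNorm_lt_top hr0 hr hh.2) (measure_lt_top μ _)

/-- Integrating the translates of an `L^r` function against an integrable kernel gives an `L^r`
function. -/
theorem MeasureTheory.MemLp.integral_kernel_mul_comp_sub {c : X → G} (hc : Measurable c)
    {k : X → ℂ} (hkm : StronglyMeasurable k) (hk : Integrable k μ)
    {h : G → ℂ} (hm : StronglyMeasurable h) {r : ℝ≥0∞} (hr : 1 ≤ r) (hh : MemLp h r ν) :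
    MemLp (fun z => ∫ w, k w * h (z - c w) ∂μ) r ν := by
  have hr0 : r ≠ 0 := (zero_lt_one.trans_le hr).ne'
  -- For the finite measure `|k| μ`, Hölder bounds the `L¹` norm by the `L^r` norm, with constant
  -- `C` below.
  set μ' := μ.withDensity fun w => ‖k w‖ₑ with hμ'
  have : IsFiniteMeasure μ' := isFiniteMeasure_withDensity hk.2.ne
  have hsub : ∀ z, Measurable fun w => z - c w := fun z => measurable_const.sub hc
  have hsm : ∀ z, StronglyMeasurable fun w => h (z - c w) := fun z =>
    hm.comp_measurable (hsub z)
  have hTm : StronglyMeasurable fun z => ∫ w, k w * h (z - c w) ∂μ := by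
    refine StronglyMeasurable.integral_prod_right' (f := fun p : G × X => k p.2 * h (p.1 - c p.2)) ?_
    exact (hkm.comp_measurable measurable_snd).mul
      (hm.comp_measurable (measurable_fst.sub (hc.comp measurable_snd)))
  refine ⟨hTm.aestronglyMeasurable, ?_⟩
  set C := μ' Set.univ ^ (1 / (1 : ℝ≥0∞).toReal - 1 / r.toReal) with hC
  have hCtop : C < ∞ := by
    refine ENNReal.rpow_lt_top_of_nonneg ?_ (measure_ne_top μ' _)
    rcases eq_or_ne r ∞ with rfl | hrt
    · simp
    · have h1 : 1 ≤ r.toReal := by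
        rw [← ENNReal.toReal_one]; exact ENNReal.toReal_mono hrt hr
      rw [ENNReal.toReal_one, sub_nonneg]
      exact one_div_le_one_div_of_le one_pos h1
  have hpt : ∀ z, ‖∫ w, k w * h (z - c w) ∂μ‖ₑ ≤ eLpNorm (fun w => h (z - c w)) r μ' * C := by
    intro z
    calc ‖∫ w, k w * h (z - c w) ∂μ‖ₑ ≤ ∫⁻ w, ‖k w * h (z - c w)‖ₑ ∂μ :=
          enorm_integral_le_lintegral_enorm _
      _ = eLpNorm (fun w => h (z - c w)) 1 μ' := by
          rw [eLpNorm_one_eq_lintegral_enorm, hμ', lintegral_withDensity_eq_lintegral_mul _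
            hkm.measurable.enorm (hsm z).measurable.enorm]
          simp [enorm_mul]
      _ ≤ _ := eLpNorm_le_eLpNorm_mul_rpow_measure_univ hr (hsm z).aestronglyMeasurable
  rcases eq_or_ne r ∞ with rfl | hrt
  · have hae : ∀ᵐ p ∂μ'.prod ν, ‖h (p.2 - c p.1)‖ₑ ≤ eLpNorm h ∞ ν := by
      have hq : Measure.QuasiMeasurePreserving (fun p : X × G => p.2 - c p.1) (μ'.prod ν) ν :=
        Measure.quasiMeasurePreserving_snd.comp
          (measurePreserving_sub_shear (μ := μ') (ν := ν) hc).quasiMeasurePreserving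
      rw [eLpNorm_exponent_top]
      exact hq.ae (enorm_ae_le_eLpNormEssSup h ν)
    have hae' : ∀ᵐ z ∂ν, eLpNorm (fun w => h (z - c w)) ∞ μ' ≤ eLpNorm h ∞ ν := by
      filter_upwards [Measure.ae_ae_of_ae_prod
        ((Measure.measurePreserving_swap (μ := ν) (ν := μ')).quasiMeasurePreserving.ae hae)]
        with z hz
      rw [eLpNorm_exponent_top (f := fun w => h (z - c w))]
      exact essSup_le_of_ae_le _ hz
    rw [eLpNorm_exponent_top]
    refine (essSup_le_of_ae_le (eLpNorm h ∞ ν * C) ?_).trans_lt (ENNReal.mul_lt_top hh.2 hCtop)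
    filter_upwards [hae'] with z hz
    exact (hpt z).trans (by gcongr)
  · refine (eLpNorm_lt_top_iff_lintegral_rpow_enorm_lt_top hr0 hrt).2 ?_
    calc ∫⁻ z, ‖∫ w, k w * h (z - c w) ∂μ‖ₑ ^ r.toReal ∂ν
        ≤ ∫⁻ z, eLpNorm (fun w => h (z - c w)) r μ' ^ r.toReal * C ^ r.toReal ∂ν := by
          refine lintegral_mono fun z => ?_
          rw [← ENNReal.mul_rpow_of_nonneg _ _ ENNReal.toReal_nonneg]
          exact ENNReal.rpow_le_rpow (hpt z) ENNReal.toReal_nonneg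
      _ = (∫⁻ z, eLpNorm (fun w => h (z - c w)) r μ' ^ r.toReal ∂ν) * C ^ r.toReal :=
          lintegral_mul_const' _ _ (ENNReal.rpow_ne_top_of_nonneg ENNReal.toReal_nonneg hCtop.ne)
      _ < ∞ := ENNReal.mul_lt_top (lintegral_eLpNorm_comp_sub_rpow_lt_top hc hm hr0 hrt hh)
          (ENNReal.rpow_lt_top_of_nonneg ENNReal.toReal_nonneg hCtop.ne)

/-- Fubini and the shear give the adjoint of the kernel operator, with the shift reversed. -/
theorem integral_kernel_mul_comp_sub_mul {c : X → G} (hc : Measurable c) {k : X → ℂ}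
    (hk : Integrable k μ) {h χ : G → ℂ} (hh : Integrable h ν) (hχ : StronglyMeasurable χ)
    {C : ℝ} (hC : ∀ z, ‖χ z‖ ≤ C) :
    ∫ z, (∫ w, k w * h (z - c w) ∂μ) * χ z ∂ν
      = ∫ z, h z * ∫ w, k w * χ (z + c w) ∂μ ∂ν := by
  have hmp := measurePreserving_sub_shear (μ := μ) (ν := ν) hc
  have hmp' := measurePreserving_add_shear (μ := μ) (ν := ν) hc
  set F : X × G → ℂ := fun p => k p.1 * h p.2 * χ (p.2 + c p.1) with hF
  have hFi : Integrable F (μ.prod ν) := by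
    refine (hk.mul_prod hh).mul_bdd (c := C) ?_ (Filter.Eventually.of_forall fun p => hC _)
    exact (hχ.comp_measurable (measurable_snd.comp hmp'.measurable)).aestronglyMeasurable
  have hFs : (fun p : X × G => k p.1 * h (p.2 - c p.1) * χ p.2)
      = F ∘ fun p : X × G => (p.1, p.2 - c p.1) := by
    funext p; simp [hF]
  have hFi' : Integrable (fun p : X × G => k p.1 * h (p.2 - c p.1) * χ p.2) (μ.prod ν) := by
    rw [hFs]; exact hmp.integrable_comp_of_integrable hFi
  have heq : ∫ p, k p.1 * h (p.2 - c p.1) * χ p.2 ∂μ.prod ν = ∫ p, F p ∂μ.prod ν := by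
    rw [hFs]
    conv_rhs => rw [← hmp.map_eq]
    rw [integral_map hmp.measurable.aemeasurable (by rw [hmp.map_eq]; exact hFi.1)]
    rfl
  rw [integral_prod_symm _ hFi', integral_prod_symm _ hFi] at heq
  simp only [hF, integral_mul_const] at heq
  rw [heq]
  refine integral_congr_ae (Filter.Eventually.of_forall fun z => ?_)
  simp only [← integral_const_mul]
  exact integral_congr_ae (Filter.Eventually.of_forall fun w => by ring)

end PartialConvolution

/-! ### The Cauchy kernel and the polydisc -/

theorem integrableOn_inv_ball (R : ℝ) :
    IntegrableOn (fun w : ℂ => w⁻¹) (Metric.ball 0 R) := by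
  have h : IntegrableOn (fun w : ℂ => ‖w‖⁻¹) (Metric.ball 0 R) := by
    rw [integrableOn_fun_norm_addHaar (μ := (volume : Measure ℂ)) (f := fun y : ℝ => y⁻¹)]
    refine (integrableOn_const (C := (1 : ℝ)) (by simp)).congr_fun ?_ measurableSet_Ioo
    intro y hy
    simp [Complex.finrank_real_complex, hy.1.ne']
  refine h.mono' (measurable_inv.aestronglyMeasurable) (Filter.Eventually.of_forall fun w => ?_)
  simp

theorem unitPolydisc_subset_closedUnitPolydisc (n : ℕ) :
    unitPolydisc n ⊆ closedUnitPolydisc n := fun _ hz i => (hz i).le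

theorem closedUnitPolydisc_eq_closedBall (n : ℕ) :
    closedUnitPolydisc n = Metric.closedBall 0 1 := by
  ext z
  simp [closedUnitPolydisc, pi_norm_le_iff_of_nonneg]

theorem isCompact_closedUnitPolydisc (n : ℕ) : IsCompact (closedUnitPolydisc n) := by
  rw [closedUnitPolydisc_eq_closedBall]
  exact isCompact_closedBall 0 1

theorem unitPolydisc_eq_ball (n : ℕ) : unitPolydisc n = Metric.ball 0 1 := by
  ext z
  simp [unitPolydisc, pi_norm_lt_iff]

theorem measurableSet_unitPolydisc (n : ℕ) : MeasurableSet (unitPolydisc n) := by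
  rw [unitPolydisc_eq_ball]
  exact measurableSet_ball

theorem volume_unitPolydisc_lt_top (n : ℕ) : volume (unitPolydisc n) < ∞ := by
  rw [unitPolydisc_eq_ball]
  exact measure_ball_lt_top

theorem isometry_piSingle {n : ℕ} (j : Fin n) :
    Isometry (fun w : ℂ => (Pi.single j w : Fin n → ℂ)) :=
  Isometry.of_dist_eq fun x y => by
    rw [dist_eq_norm, ← Pi.single_sub, Pi.norm_single, dist_eq_norm]

/-! ### Cauchy–Pompeiu along one coordinate -/

section Wirtinger

variable {n : ℕ} {j : Fin n} {φ : (Fin n → ℂ) → ℂ}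

theorem wirtingerBar_eq_zero_of_notMem_tsupport {z : Fin n → ℂ} (hz : z ∉ tsupport φ) :
    wirtingerBar j φ z = 0 := by
  have : fderiv ℝ φ z = 0 := by
    by_contra h
    exact hz (tsupport_fderiv_subset ℝ (subset_tsupport _ h))
  simp [wirtingerBar, this]

theorem continuous_wirtingerBar (hφ : ContDiff ℝ 1 φ) : Continuous (wirtingerBar j φ) := by
  have h := hφ.continuous_fderiv one_ne_zero
  unfold wirtingerBar
  fun_prop

theorem continuous_mul_wirtingerBar {U : Set (Fin n → ℂ)} (hU : IsOpen U)
    {F : (Fin n → ℂ) → ℂ} (hF : ContinuousOn F U) (hφ : ContDiff ℝ 1 φ) (hs : tsupport φ ⊆ U) :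
    Continuous fun z => F z * wirtingerBar j φ z := by
  refine continuous_iff_continuousAt.2 fun z => ?_
  by_cases hz : z ∈ tsupport φ
  · exact (hF.continuousAt (hU.mem_nhds (hs hz))).mul (continuous_wirtingerBar hφ).continuousAt
  · refine (continuousAt_const (y := (0 : ℂ))).congr ?_
    filter_upwards [(isClosed_tsupport φ).isOpen_compl.mem_nhds hz] with y hy
    rw [wirtingerBar_eq_zero_of_notMem_tsupport hy, mul_zero]

/-- The Cauchy–Pompeiu formula along the `j`-th coordinate for the product of a holomorphic function
and a test function. -/
theorem integral_inv_mul_mul_wirtingerBar {U : Set (Fin n → ℂ)} (hU : IsOpen U)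
    {F : (Fin n → ℂ) → ℂ} (hF : DifferentiableOn ℂ F U) (hφ : ContDiff ℝ 1 φ)
    (hc : HasCompactSupport φ) (hs : tsupport φ ⊆ U) (z : Fin n → ℂ) :
    ∫ w : ℂ, w⁻¹ * (F (z + Pi.single j w) * wirtingerBar j φ (z + Pi.single j w))
      = -(Real.pi : ℂ) * (F z * φ z) := by
  set L : ℂ → Fin n → ℂ := fun w => z + Pi.single j w with hL
  have hLd : ∀ w, HasFDerivAt L (ContinuousLinearMap.single ℂ (fun _ : Fin n => ℂ) j) w := fun w =>
    (ContinuousLinearMap.single ℂ (fun _ : Fin n => ℂ) j).hasFDerivAt.const_add z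
  have hLc : Continuous L := continuous_iff_continuousAt.2 fun w => (hLd w).continuousAt
  have hLsm : ContDiff ℝ 1 L :=
    contDiff_const.add (ContinuousLinearMap.single ℝ (fun _ : Fin n => ℂ) j).contDiff
  have hLe : Topology.IsClosedEmbedding L :=
    ((IsometryEquiv.addLeft z).isometry.comp (isometry_piSingle j)).isClosedEmbedding
  set u : ℂ → ℂ := fun w => F (L w) * φ (L w) with hu
  have hV : IsOpen (L ⁻¹' U) := hU.preimage hLc
  have hFL : DifferentiableOn ℂ (F ∘ L) (L ⁻¹' U) := fun w hw =>
    ((hF.differentiableAt (hU.mem_nhds hw)).comp w (hLd w).differentiableAt).differentiableWithinAt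
  have hφd : Differentiable ℝ φ := hφ.differentiable one_ne_zero
  have hu0 : ∀ w, L w ∉ tsupport φ → u =ᶠ[nhds w] fun _ => 0 := fun w hw => by
    filter_upwards [hLc.continuousAt.preimage_mem_nhds
      ((isClosed_tsupport φ).isOpen_compl.mem_nhds hw)] with y hy
    simp only [hu, image_eq_zero_of_notMem_tsupport hy, mul_zero]
  have hucd : ContDiff ℝ 1 u := contDiff_iff_contDiffAt.2 fun w => by
    by_cases hw : L w ∈ tsupport φ
    · have h1 : ContDiffAt ℂ 1 (F ∘ L) w :=
        (hFL.contDiffOn hV).contDiffAt (hV.mem_nhds (hs hw))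
      exact (h1.restrict_scalars ℝ).mul (hφ.comp hLsm).contDiffAt
    · exact contDiffAt_const.congr_of_eventuallyEq (hu0 w hw)
  have huc : HasCompactSupport u := (hc.comp_isClosedEmbedding hLe).mul_left (f := F ∘ L)
  have hdbar : ∀ w, F (L w) * wirtingerBar j φ (L w)
      = (1 / 2 : ℂ) * (fderiv ℝ u w 1 + Complex.I * fderiv ℝ u w Complex.I) := by
    intro w
    by_cases hw : L w ∈ tsupport φ
    · have h1 := ((hFL.differentiableAt (hV.mem_nhds (hs hw))).hasDerivAt.hasFDerivAt).restrictScalars ℝ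
      have h2 : HasFDerivAt (φ ∘ L) _ w :=
        (hφd (L w)).hasFDerivAt.comp w ((hLd w).restrictScalars ℝ)
      have h3 : HasFDerivAt u _ w := h1.mul h2
      rw [h3.fderiv]
      simp [wirtingerBar]
      -- The Cauchy–Riemann equation: the derivative of `F` enters with the factor `1 + i² = 0`.
      linear_combination (-(1 / 2 : ℂ) * φ (L w) * deriv (F ∘ L) w) * Complex.I_sq
    · rw [(hu0 w hw).fderiv_eq, wirtingerBar_eq_zero_of_notMem_tsupport hw]
      simp
  change ∫ w : ℂ, w⁻¹ * (F (L w) * wirtingerBar j φ (L w)) = _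
  simp only [hdbar]
  rw [integral_inv_mul_dbar_eq hucd huc]
  simp [hu, hL]

/-- Two points of the unit disc are less than 2 apart, so the cut-off loses nothing. -/
theorem setIntegral_inv_mul_mul_wirtingerBar {U : Set (Fin n → ℂ)} (hU : IsOpen U)
    (hDU : unitPolydisc n ⊆ U) {F : (Fin n → ℂ) → ℂ} (hF : DifferentiableOn ℂ F U)
    (hφ : ContDiff ℝ 1 φ) (hc : HasCompactSupport φ) (hs : tsupport φ ⊆ unitPolydisc n)
    {z : Fin n → ℂ} (hz : z ∈ unitPolydisc n) :
    ∫ w in Metric.ball (0 : ℂ) 2, w⁻¹ * (F (z + Pi.single j w) * wirtingerBar j φ (z + Pi.single j w))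
      = -(Real.pi : ℂ) * (F z * φ z) := by
  rw [← integral_inv_mul_mul_wirtingerBar hU hF hφ hc (hs.trans hDU) (j := j)]
  refine setIntegral_eq_integral_of_forall_compl_eq_zero fun w hw => ?_
  rw [wirtingerBar_eq_zero_of_notMem_tsupport, mul_zero, mul_zero]
  intro hmem
  have h1 : ‖z j + w‖ < 1 := by simpa using hs hmem j
  have h2 : ‖w‖ ≤ ‖z j + w‖ + ‖z j‖ := by simpa using norm_sub_le (z j + w) (z j)
  have h3 : 2 ≤ ‖w‖ := by simpa using hw
  linarith [hz j]

end Wirtinger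

/-! ### The Cauchy transform on `L^r` -/

theorem MeasureTheory.MemLp.integrable_of_ae_eq_zero {α : Type*} [MeasurableSpace α]
    {μ : Measure α} {g : α → ℂ} {r : ℝ≥0∞} (hr : 1 ≤ r) (hg : MemLp g r μ) {K : Set α}
    (hKm : MeasurableSet K) (hK : μ K < ∞) (h0 : ∀ᵐ z ∂μ, z ∉ K → g z = 0) : Integrable g μ := by
  have : IsFiniteMeasure (μ.restrict K) := ⟨by simpa using hK⟩
  have h1 : IntegrableOn g K μ := (hg.restrict K).integrable hr
  refine (h1.integrable_indicator hKm).congr ?_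
  filter_upwards [h0] with z hz
  by_cases hzK : z ∈ K
  · simp [hzK]
  · simp [hzK, hz hzK]

theorem ContinuousOn.memLp_mul_of_ae_eq_zero {n : ℕ} {r : ℝ≥0∞} {K : Set (Fin n → ℂ)}
    (hK : IsCompact K) {F g : (Fin n → ℂ) → ℂ} (hF : ContinuousOn F K) (hg : MemLp g r)
    (h0 : ∀ᵐ z, z ∉ K → g z = 0) : MemLp (fun z => F z * g z) r := by
  have hKm := hK.measurableSet
  obtain ⟨C, hC⟩ := hK.exists_bound_of_continuousOn hF
  have h1 : MemLp (K.indicator fun z => F z * g z) r := by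
    refine MemLp.of_le_mul (c := max C 0) hg ?_ (Filter.Eventually.of_forall fun z => ?_)
    · exact (aestronglyMeasurable_indicator_iff hKm).2
        ((hF.aestronglyMeasurable hKm).mul hg.1.restrict)
    · by_cases hz : z ∈ K
      · rw [Set.indicator_of_mem hz, norm_mul]
        gcongr
        exact (hC z hz).trans (le_max_left _ _)
      · rw [Set.indicator_of_notMem hz, norm_zero]
        positivity
  refine h1.ae_eq ?_
  filter_upwards [h0] with z hz
  by_cases hzK : z ∈ K
  · simp [hzK]
  · simp [hzK, hz hzK]

/-- The Cauchy transform in the `j`-th variable, with the kernel cut off at radius `2`. -/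
noncomputable def cauchyTransform {n : ℕ} (j : Fin n) (h : (Fin n → ℂ) → ℂ) (z : Fin n → ℂ) : ℂ :=
  ∫ w in Metric.ball (0 : ℂ) 2, ((Real.pi : ℂ)⁻¹ * w⁻¹) * h (z - Pi.single j w)

theorem memLp_cauchyTransform {n : ℕ} (j : Fin n) {h : (Fin n → ℂ) → ℂ}
    (hm : StronglyMeasurable h) {r : ℝ≥0∞} (hr : 1 ≤ r) (hh : MemLp h r) :
    MemLp (cauchyTransform j h) r := by
  have hk : Integrable (fun w : ℂ => (Real.pi : ℂ)⁻¹ * w⁻¹)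
      (volume.restrict (Metric.ball (0 : ℂ) 2)) := (integrableOn_inv_ball 2).const_mul _
  exact hh.integral_kernel_mul_comp_sub (isometry_piSingle j).continuous.measurable
    (measurable_inv.const_mul _).stronglyMeasurable hk hm hr

/-- `∂(F · Th)/∂z̄_j = F h` weakly on the polydisc, for holomorphic `F`. -/
theorem integral_cauchyTransform_mul_wirtingerBar {n : ℕ} {j : Fin n} {h : (Fin n → ℂ) → ℂ}
    (hh : Integrable h) (h0 : ∀ᵐ z, z ∉ unitPolydisc n → h z = 0)
    {U : Set (Fin n → ℂ)} (hU : IsOpen U) (hDU : unitPolydisc n ⊆ U)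
    {F : (Fin n → ℂ) → ℂ} (hF : DifferentiableOn ℂ F U) {φ : (Fin n → ℂ) → ℂ}
    (hφ : ContDiff ℝ 1 φ) (hc : HasCompactSupport φ) (hs : tsupport φ ⊆ unitPolydisc n) :
    ∫ z in unitPolydisc n, F z * cauchyTransform j h z * wirtingerBar j φ z
      = -∫ z in unitPolydisc n, F z * h z * φ z := by
  have hk : Integrable (fun w : ℂ => (Real.pi : ℂ)⁻¹ * w⁻¹)
      (volume.restrict (Metric.ball (0 : ℂ) 2)) := (integrableOn_inv_ball 2).const_mul _
  have hχ : Continuous fun z => F z * wirtingerBar j φ z :=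
    continuous_mul_wirtingerBar hU hF.continuousOn hφ (hs.trans hDU)
  have hχ0 : ∀ z, z ∉ tsupport φ → F z * wirtingerBar j φ z = 0 := fun z hz => by
    rw [wirtingerBar_eq_zero_of_notMem_tsupport hz, mul_zero]
  obtain ⟨C, hC⟩ := (HasCompactSupport.intro hc hχ0).exists_bound_of_continuous hχ
  have key := integral_kernel_mul_comp_sub_mul (ν := (volume : Measure (Fin n → ℂ)))
    (isometry_piSingle j).continuous.measurable hk hh hχ.stronglyMeasurable hC
  calc ∫ z in unitPolydisc n, F z * cauchyTransform j h z * wirtingerBar j φ z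
      = ∫ z, F z * cauchyTransform j h z * wirtingerBar j φ z :=
        setIntegral_eq_integral_of_forall_compl_eq_zero fun z hz => by
          rw [wirtingerBar_eq_zero_of_notMem_tsupport fun hz' => hz (hs hz'), mul_zero]
    _ = ∫ z, cauchyTransform j h z * (F z * wirtingerBar j φ z) :=
        integral_congr_ae (Filter.Eventually.of_forall fun z => by ring)
    _ = _ := key
    _ = ∫ z, -(F z * h z * φ z) := by
        refine integral_congr_ae ?_
        filter_upwards [h0] with z hz
        by_cases hzD : z ∈ unitPolydisc n
        · simp only [mul_assoc]
          rw [integral_const_mul, setIntegral_inv_mul_mul_wirtingerBar hU hDU hF hφ hc hs hzD]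
          have : (Real.pi : ℂ) ≠ 0 := by exact_mod_cast Real.pi_ne_zero
          field_simp
        · simp [hz hzD]
    _ = -∫ z in unitPolydisc n, F z * h z * φ z := by
        rw [integral_neg, setIntegral_eq_integral_of_forall_compl_eq_zero fun z hz => by
          rw [image_eq_zero_of_notMem_tsupport fun hz' => hz (hs hz'), mul_zero]]

theorem InLr.mul_continuousOn {n : ℕ} {r : ℝ≥0∞} {F g : (Fin n → ℂ) → ℂ}
    (hF : ContinuousOn F (closedUnitPolydisc n)) (hg : InLr r (unitPolydisc n) g) :
    InLr r (unitPolydisc n) (fun z => F z * g z) := by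
  have hDm := measurableSet_unitPolydisc n
  obtain ⟨C, hC⟩ := (isCompact_closedUnitPolydisc n).exists_bound_of_continuousOn hF
  have hFm := (hF.mono (unitPolydisc_subset_closedUnitPolydisc n)).aestronglyMeasurable
    (μ := volume) hDm
  refine MemLp.of_le_mul (c := C) hg (hFm.mul hg.1) ?_
  filter_upwards [ae_restrict_mem hDm] with z hz
  rw [norm_mul]
  gcongr
  exact hC z (unitPolydisc_subset_closedUnitPolydisc n hz)

/-- The quotient is `g` off the zeros of `F` and, since `0⁻¹ = 0`, vanishes on them; so `Z` need not
be a null set. -/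
theorem InLr.inv_mul_mul {n : ℕ} {r : ℝ≥0∞} {F g : (Fin n → ℂ) → ℂ}
    (hF : ContinuousOn F (closedUnitPolydisc n)) (hg : InLr r (unitPolydisc n) g) :
    InLr r (unitPolydisc n) (fun z => (F z)⁻¹ * (F z * g z)) := by
  have hFm := (hF.mono (unitPolydisc_subset_closedUnitPolydisc n)).aestronglyMeasurable
    (μ := volume) (measurableSet_unitPolydisc n)
  refine MemLp.of_le hg (hFm.aemeasurable.inv.aestronglyMeasurable.mul (hFm.mul hg.1))
    (Filter.Eventually.of_forall fun z => ?_)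
  by_cases hz : F z = 0
  · simp [hz]
  · rw [inv_mul_cancel_left₀ hz]

theorem inLrc_zero {n : ℕ} {r : ℝ≥0∞} (Ω : Set (Fin n → ℂ)) : InLrc r Ω (fun _ => 0) :=
  ⟨MemLp.zero', ∅, isCompact_empty, Set.empty_subset _, by simp⟩

theorem indexSign_eq_one {n : ℕ} {I : Finset (Fin n)} {j : Fin n} (hj : ∀ i, j ≤ i) :
    indexSign I j = 1 := by
  have : I.filter (fun i => i < j) = ∅ := Finset.filter_false_of_mem fun i _ => not_lt.2 (hj i)
  simp [indexSign, this]

/-! ### Solving the equation -/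

theorem exists_weak_solution_divisible_by_holomorphic {n : ℕ} (j : Fin n) {r : ℝ≥0∞} (hr : 1 ≤ r)
    {U : Set (Fin n → ℂ)} (hU : IsOpen U) (hDU : closedUnitPolydisc n ⊆ U)
    {F : (Fin n → ℂ) → ℂ} (hF : DifferentiableOn ℂ F U) {g : (Fin n → ℂ) → ℂ}
    (hg : InLrc r (unitPolydisc n ∩ {z | F z ≠ 0}) g) :
    ∃ T : (Fin n → ℂ) → ℂ, MemLp T r ∧ ∀ φ : (Fin n → ℂ) → ℂ, ContDiff ℝ 1 φ →
      HasCompactSupport φ → tsupport φ ⊆ unitPolydisc n →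
      ∫ z in unitPolydisc n, F z * T z * wirtingerBar j φ z
        = -∫ z in unitPolydisc n, g z * φ z := by
  obtain ⟨hgLp, K, hK, hKs, hK0⟩ := hg
  have hD := unitPolydisc_subset_closedUnitPolydisc n
  have hFK : ContinuousOn (fun z => (F z)⁻¹) K :=
    (hF.continuousOn.mono fun z hz => hDU (hD (hKs hz).1)).inv₀ fun z hz => (hKs hz).2
  have hq : MemLp (fun z => (F z)⁻¹ * g z) r := hFK.memLp_mul_of_ae_eq_zero hK hgLp hK0
  -- The transform integrates over complex lines, null sets when `n > 1`, so a strongly measurable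
  -- representative is fixed.
  set h := hq.1.mk with hh
  have hae : ∀ᵐ z, (F z)⁻¹ * g z = h z := hq.1.ae_eq_mk
  have hLp : MemLp h r := hq.ae_eq hq.1.ae_eq_mk
  have h0 : ∀ᵐ z, z ∉ K → h z = 0 := by
    filter_upwards [hae, hK0] with z hz hz0 hzK
    rw [← hz, hz0 hzK, mul_zero]
  refine ⟨cauchyTransform j h, memLp_cauchyTransform j hq.1.stronglyMeasurable_mk hr hLp,
    fun φ hφ hc hs => ?_⟩
  rw [integral_cauchyTransform_mul_wirtingerBar
    (hLp.integrable_of_ae_eq_zero hr hK.measurableSet hK.measure_lt_top h0)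
    (h0.mono fun z hz hzD => hz fun hzK => hzD (hKs hzK).1) hU (hD.trans hDU) hF hφ hc hs]
  congr 1
  refine integral_congr_ae (ae_restrict_of_ae ?_)
  filter_upwards [hae, hK0] with z hz hz0
  by_cases hzK : z ∈ K
  · rw [← hz, mul_inv_cancel_left₀ (hKs hzK).2]
  · rw [← hz, hz0 hzK]; ring

theorem mainTheorem4 {n : ℕ} (hn : 1 ≤ n) {r : ℝ≥0∞} (hr : 1 ≤ r)
    (f : (Fin n → ℂ) → ℂ) (U : Set (Fin n → ℂ)) (hU : IsOpen U)
    (hDU : closedUnitPolydisc n ⊆ U) (hf : DifferentiableOn ℂ f U)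
    (ω : ZeroForm n n)
    (hω : ∀ I, InLrc r (unitPolydisc n \ {z | f z = 0}) (ω I)) (k : ℕ) :
    ∃ η : ZeroForm n (n - 1),
      (∀ J, InLr r (unitPolydisc n) (η J)) ∧
      WeakDbarEq (Nat.sub_add_cancel hn) (unitPolydisc n) η ω ∧
      (∀ J, InLr r (unitPolydisc n) (fun z => (f z ^ k)⁻¹ * η J z)) ∧
      ∃ J₀, ∀ J, J ≠ J₀ → InLrc r (unitPolydisc n \ {z | f z = 0}) (η J) := by
  classical
  -- The smallest index makes the sign in `∂̄` equal to 1.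
  set j : Fin n := ⟨0, hn⟩ with hj
  set I₀ : {J : Finset (Fin n) // J.card = n} := ⟨Finset.univ, by simp⟩ with hI₀
  set J₀ : {J : Finset (Fin n) // J.card = n - 1} :=
    eraseIndex (Nat.sub_add_cancel hn) I₀ ⟨j, Finset.mem_univ j⟩ with hJ₀
  have hI : ∀ I : {J : Finset (Fin n) // J.card = n}, I = I₀ := fun I =>
    Subtype.ext ((Finset.card_eq_iff_eq_univ _).1 (by simpa using I.2))
  have hfk : DifferentiableOn ℂ (fun z => f z ^ k) U := hf.pow k
  have hfc : ContinuousOn (fun z => f z ^ k) (closedUnitPolydisc n) := hfk.continuousOn.mono hDU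
  obtain ⟨T, hT, hTw⟩ := exists_weak_solution_divisible_by_holomorphic j hr hU hDU hfk (g := ω I₀) (by
    obtain ⟨h1, K, hK, hKs, hK0⟩ := hω I₀
    exact ⟨h1, K, hK, fun z hz => ⟨(hKs hz).1, pow_ne_zero k (hKs hz).2⟩, hK0⟩)
  have hTD : InLr r (unitPolydisc n) T := hT.restrict _
  set η : ZeroForm n (n - 1) := fun J => if J = J₀ then fun z => f z ^ k * T z else fun _ => 0 with hη
  have hη₀ : η J₀ = fun z => f z ^ k * T z := if_pos rfl
  have hη₁ : ∀ J, J ≠ J₀ → η J = fun _ => 0 := fun J hJ => if_neg hJ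
  have hηLr : ∀ J, InLr r (unitPolydisc n) (η J) := fun J => by
    by_cases hJ : J = J₀
    · rw [hJ, hη₀]
      exact hTD.mul_continuousOn hfc
    · rw [hη₁ J hJ]
      exact MemLp.zero'
  have : IsFiniteMeasure (volume.restrict (unitPolydisc n)) :=
    ⟨by simpa using volume_unitPolydisc_lt_top n⟩
  refine ⟨η, hηLr, ⟨fun J => IntegrableOn.locallyIntegrableOn ((hηLr J).integrable hr),
    fun I => ((hω I).1.locallyIntegrable hr).locallyIntegrableOn _, fun I φ hφ hc hs => ?_⟩,
    fun J => ?_, J₀, fun J hJ => ?_⟩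
  · rw [hI I, Finset.sum_eq_single ⟨j, Finset.mem_univ j⟩]
    · rw [indexSign_eq_one fun i => Nat.zero_le _, one_mul, ← hJ₀, hη₀]
      exact hTw φ (hφ.of_le (by exact_mod_cast le_top)) hc hs
    · intro i _ hi
      have hne : eraseIndex (Nat.sub_add_cancel hn) I₀ i ≠ J₀ := fun he => by
        have h1 : Finset.univ.erase i.1 = Finset.univ.erase j := congrArg Subtype.val he
        exact hi (Subtype.ext (Finset.erase_injOn _ (Finset.mem_univ _) (Finset.mem_univ _) h1))
      rw [hη₁ _ hne]
      simp
    · intro h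
      exact absurd (Finset.mem_univ _) h
  · by_cases hJ : J = J₀
    · rw [hJ, hη₀]
      exact hTD.inv_mul_mul hfc
    · rw [hη₁ J hJ]
      simp only [mul_zero]
      exact MemLp.zero'
  · rw [hη₁ J hJ]
    exact inLrc_zero _
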